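/- Let $K$ be an infinite field, $k$ a subfield of $K$, $u=(u_1,\ldots,u_m)$ and $X=(X_1,\ldots,X_n)$ families of indeterminates, $R=k(u)[X]$, $P$ a prime ideal of $R$ and $S=R_P$. For $\alpha\in K^m$ put $R_\alpha=k(\alpha)[X]$. "For almost all $\alpha$" means: for all $\alpha\in K^m$ outside some proper algebraic subvariety of $K^m$. Let $P_\alpha$ be the ideal of $R_\alpha$ generated by all $f(\alpha,X)$ with $f(u,X)\in P\cap k[u,X]$. For an associated prime ideal $\wp$ of $P_\alpha$ (that is, of the $R_\alpha$-module $R_\alpha/P_\alpha$), the local ring $S_\alpha=(R_\alpha)_\wp$ is called a specialization of $S$. If $f=p(u,X)/q(u)\in R$ with $p\in k[u,X]$, $q\in k[u]$ and $q(\alpha)\neq 0$, put $f_\alpha=p(\alpha,X)/q(\alpha)\in R_\alpha$. If $a=f/g\in S$ with $f,g\in R$, $g\notin P$, such that $f_\alpha,g_\alpha$ are defined and $g_\alpha\notin\wp$, put $a_\alpha=f_\alpha/g_\alpha\in S_\alpha$; this does not depend on the choices. For a matrix $A=(a_{ij})$ over $S$ put $A_\alpha=((a_{ij})_\alpha)$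 whenever all entries are defined. If $\phi:F\to G$ is a homomorphism of free $S$-modules of finite rank, given by $A$ with respect to fixed bases, then $\phi_\alpha:F_\alpha\to G_\alpha$ denotes the homomorphism of free $S_\alpha$-modules of the same ranks given by $A_\alpha$. For a finitely generated $S$-module $L$ with a finite free presentation $F_1\xrightarrow{\phi}F_0\to L\to 0$ put $L_\alpha=\operatorname{Coker}\phi_\alpha$. If $v:L\to M$ is a homomorphism of finitely generated $S$-modules, $G_1\xrightarrow{\psi}G_0\to M\to 0$ is a finite free presentation of $M$, and $v_i:F_i\to G_i$ ($i=0,1$) lift $v$ to the presentations, then $v_\alpha:L_\alpha\to M_\alpha$ denotes the homomorphism induced by $(v_0)_\alpha$; it is defined if all matrices involved specialize and $\psi_\alpha(v_1)_\alpha=(v_0)_\alpha\phi_\alpha$. **Theorem 2.2.** Let $0\to L\xrightarrow{v} M\xrightarrow{w} N\to 0$ be an exact sequence of finitely generated $S$-modules, with any fixed finite free presentations of $L,M,N$ and any fixed lifts of $v,w$ to them. Then, for almost all $\alpha$ and for every associated prime ideal $\wp$ of $P_\alpha$, with $S_\alpha=(R_\alpha)_\wp$, the specializations $v_\alpha$ and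 $w_\alpha$ are defined and the sequence of $S_\alpha$-modules $0\to L_\alpha\xrightarrow{v_\alpha} M_\alpha\xrightarrow{w_\alpha} N_\alpha\to 0$ is exact. -/

import Mathlib

open MvPolynomial

noncomputable section

namespace ModuleSpecialization

/-- The polynomial ring `R = k(u)[X]` over the rational function field `k(u)`, where
`u = (u_1, …, u_m)` and `X = (X_1, …, X_n)`. -/
abbrev R (k : Type*) [Field k] (m n : ℕ) : Type _ :=
  MvPolynomial (Fin n) (FractionRing (MvPolynomial (Fin m) k))

/-- The inclusion `k[u, X] → R`, where `k[u, X]` is written as `k[u][X]`. -/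
def incl (k : Type*) [Field k] (m n : ℕ) :
    MvPolynomial (Fin n) (MvPolynomial (Fin m) k) →+* R k m n :=
  MvPolynomial.map (algebraMap (MvPolynomial (Fin m) k) (FractionRing (MvPolynomial (Fin m) k)))

section

variable (k : Type*) {K : Type*} [Field k] [Field K] [Algebra k K] {m : ℕ}

/-- A property holds for almost all `α ∈ K^m` if it holds for all `α` outside some proper
algebraic subvariety of `K^m`. -/
def AlmostAll (p : (Fin m → K) → Prop) : Prop :=
  ∃ I : Ideal (MvPolynomial (Fin m) K),
    MvPolynomial.zeroLocus K I ≠ Set.univ ∧ ∀ α, α ∉ MvPolynomial.zeroLocus K I → p α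

/-- The field `k(α)`, the subfield of `K` generated by `k` and `α_1, …, α_m`. -/
def AdjoinField (α : Fin m → K) : Type _ :=
  IntermediateField.adjoin k (Set.range α)

instance (α : Fin m → K) : Field (AdjoinField k α) :=
  inferInstanceAs (Field (IntermediateField.adjoin k (Set.range α)))

instance (α : Fin m → K) : Algebra k (AdjoinField k α) :=
  inferInstanceAs (Algebra k (IntermediateField.adjoin k (Set.range α)))

/-- The elements `α_i` of `k(α)`. -/
def AdjoinField.gen (α : Fin m → K) (i : Fin m) : AdjoinField k α :=
  (⟨α i, IntermediateField.subset_adjoin k _ (Set.mem_range_self i)⟩ :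
    IntermediateField.adjoin k (Set.range α))

/-- The polynomial ring `R_α = k(α)[X]`. -/
abbrev RSpec (n : ℕ) (α : Fin m → K) : Type _ :=
  MvPolynomial (Fin n) (AdjoinField k α)

/-- The substitution `u ↦ α`, as a map `k[u] → k(α)`, `q(u) ↦ q(α)`. -/
def substCoeff (α : Fin m → K) : MvPolynomial (Fin m) k →+* AdjoinField k α :=
  (MvPolynomial.aeval (AdjoinField.gen k α)).toRingHom

/-- The substitution `u ↦ α`, as a map `k[u, X] → R_α`, `p(u, X) ↦ p(α, X)`. -/
def subst (n : ℕ) (α : Fin m → K) :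
    MvPolynomial (Fin n) (MvPolynomial (Fin m) k) →+* RSpec k n α :=
  MvPolynomial.map (substCoeff k α)

variable {k} {n : ℕ}

/-- The specialization `I_α` of an ideal `I` of `R`: the ideal of `R_α` generated by the
polynomials `f(α, X)` with `f(u, X) ∈ I ∩ k[u, X]`. -/
def idealSpec (I : Ideal (R k m n)) (α : Fin m → K) : Ideal (RSpec k n α) :=
  Ideal.map (subst k n α) (Ideal.comap (incl k m n) I)

/-- `f'` is the specialization `f_α` of `f ∈ R`: there are `p(u, X) ∈ k[u, X]` and `q(u) ∈ k[u]`
with `q(α) ≠ 0`, `f = p(u, X) / q(u)` and `f' = p(α, X) / q(α)`.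
(Note that `q(α) ≠ 0` implies `q ≠ 0`.) -/
def IsPolySpec (α : Fin m → K) (f : R k m n) (f' : RSpec k n α) : Prop :=
  ∃ (p : MvPolynomial (Fin n) (MvPolynomial (Fin m) k)) (q : MvPolynomial (Fin m) k),
    substCoeff k α q ≠ 0 ∧ incl k m n (C q) * f = incl k m n p ∧
      subst k n α (C q) * f' = subst k n α p

/-- The element `b` of `S_α = (R_α)_w` is the specialization `a_α` of the element `a` of
`S = R_P`: one has `a = f / g` and `b = f_α / g_α` with `f, g ∈ R`, `g ∉ P`, `g_α ∉ w`. -/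
def IsElemSpec (P : Ideal (R k m n)) [P.IsPrime] (α : Fin m → K)
    (w : Ideal (RSpec k n α)) [w.IsPrime]
    (a : Localization.AtPrime P) (b : Localization.AtPrime w) : Prop :=
  ∃ (f g : R k m n) (f' g' : RSpec k n α),
    g ∉ P ∧ g' ∉ w ∧ IsPolySpec α f f' ∧ IsPolySpec α g g' ∧
      a * algebraMap (R k m n) (Localization.AtPrime P) g =
        algebraMap (R k m n) (Localization.AtPrime P) f ∧
      b * algebraMap (RSpec k n α) (Localization.AtPrime w) g' =
        algebraMap (RSpec k n α) (Localization.AtPrime w) f'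

theorem incl_injective : Function.Injective (incl k m n) :=
  MvPolynomial.map_injective _ (IsFractionRing.injective _ _)

/-- The specialization of an element of `R` is unique whenever it is defined; more generally,
specialization is compatible with products. -/
theorem IsPolySpec.mul_eq_mul {α : Fin m → K} {f g h l : R k m n} {f' g' h' l' : RSpec k n α}
    (hf : IsPolySpec α f f') (hg : IsPolySpec α g g') (hh : IsPolySpec α h h')
    (hl : IsPolySpec α l l') (e : f * g = h * l) : f' * g' = h' * l' := by
  obtain ⟨p₁, q₁, z₁, e₁, s₁⟩ := hf
  obtain ⟨p₂, q₂, z₂, e₂, s₂⟩ := hg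
  obtain ⟨p₃, q₃, z₃, e₃, s₃⟩ := hh
  obtain ⟨p₄, q₄, z₄, e₄, s₄⟩ := hl
  have key : C q₃ * C q₄ * (p₁ * p₂) = C q₁ * C q₂ * (p₃ * p₄) := by
    apply incl_injective
    simp only [map_mul]
    rw [← e₁, ← e₂, ← e₃, ← e₄]
    linear_combination (incl k m n (C q₁) * incl k m n (C q₂) * incl k m n (C q₃) *
      incl k m n (C q₄)) * e
  have key' := congrArg (subst k n α) key
  simp only [map_mul] at key'
  rw [← s₁, ← s₂, ← s₃, ← s₄] at key'
  have nz : ∀ q : MvPolynomial (Fin m) k, substCoeff k α q ≠ 0 → subst k n α (C q) ≠ 0 := by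
    intro q hq
    simpa [subst] using hq
  have hne : subst k n α (C q₁) * subst k n α (C q₂) * subst k n α (C q₃) *
      subst k n α (C q₄) ≠ 0 :=
    mul_ne_zero (mul_ne_zero (mul_ne_zero (nz _ z₁) (nz _ z₂)) (nz _ z₃)) (nz _ z₄)
  apply mul_left_cancel₀ hne
  linear_combination key'

/-- The specialization of an element of `S` is unique whenever it is defined. -/
theorem IsElemSpec.unique {P : Ideal (R k m n)} [P.IsPrime] {α : Fin m → K}
    {w : Ideal (RSpec k n α)} [w.IsPrime] {a : Localization.AtPrime P}
    {b c : Localization.AtPrime w} (hb : IsElemSpec P α w a b) (hc : IsElemSpec P α w a c) :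
    b = c := by
  obtain ⟨f₁, g₁, f₁', g₁', hP₁, hw₁, hf₁, hg₁, ha₁, hb₁⟩ := hb
  obtain ⟨f₂, g₂, f₂', g₂', hP₂, hw₂, hf₂, hg₂, ha₂, hb₂⟩ := hc
  have e : f₁ * g₂ = f₂ * g₁ := by
    apply IsLocalization.injective (Localization.AtPrime P)
      (P.primeCompl_le_nonZeroDivisors)
    simp only [map_mul]
    rw [← ha₁, ← ha₂]
    ring
  have e' := congrArg (algebraMap (RSpec k n α) (Localization.AtPrime w))
    (hf₁.mul_eq_mul hg₂ hf₂ hg₁ e)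
  simp only [map_mul] at e'
  rw [← hb₁, ← hb₂] at e'
  have u₁ : IsUnit (algebraMap (RSpec k n α) (Localization.AtPrime w) g₁') :=
    IsLocalization.map_units (Localization.AtPrime w) (⟨g₁', hw₁⟩ : w.primeCompl)
  have u₂ : IsUnit (algebraMap (RSpec k n α) (Localization.AtPrime w) g₂') :=
    IsLocalization.map_units (Localization.AtPrime w) (⟨g₂', hw₂⟩ : w.primeCompl)
  apply (u₁.mul u₂).mul_right_cancel
  linear_combination e'

open Classical in
/-- The specialization `a_α ∈ S_α` of `a ∈ S` (and `0` for those `α` where it is undefined). -/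
def elemSpec (P : Ideal (R k m n)) [P.IsPrime] (α : Fin m → K)
    (w : Ideal (RSpec k n α)) [w.IsPrime] (a : Localization.AtPrime P) :
    Localization.AtPrime w :=
  if h : ∃ b, IsElemSpec P α w a b then h.choose else 0

theorem IsElemSpec.elemSpec_eq {P : Ideal (R k m n)} [P.IsPrime] {α : Fin m → K}
    {w : Ideal (RSpec k n α)} [w.IsPrime] {a : Localization.AtPrime P}
    {b : Localization.AtPrime w} (hb : IsElemSpec P α w a b) : elemSpec P α w a = b := by
  have h : ∃ b, IsElemSpec P α w a b := ⟨b, hb⟩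
  rw [elemSpec, dif_pos h]
  exact h.choose_spec.unique hb

/-- The specialized matrix `A_α = ((a_ij)_α)`. -/
def matrixSpec (P : Ideal (R k m n)) [P.IsPrime] (α : Fin m → K)
    (w : Ideal (RSpec k n α)) [w.IsPrime] {r s : ℕ}
    (A : Matrix (Fin r) (Fin s) (Localization.AtPrime P)) :
    Matrix (Fin r) (Fin s) (Localization.AtPrime w) :=
  A.map (elemSpec P α w)

/-- The matrix `A` can be specialized at `α`: every `(a_ij)_α` is defined and lies in `S_α`. -/
def MatrixSpecDefined (P : Ideal (R k m n)) [P.IsPrime] (α : Fin m → K)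
    (w : Ideal (RSpec k n α)) [w.IsPrime] {r s : ℕ}
    (A : Matrix (Fin r) (Fin s) (Localization.AtPrime P)) : Prop :=
  ∀ i j, ∃ b, IsElemSpec P α w (A i j) b

end

/-- A finite free presentation `S^{r₁} → S^{r₀} → L → 0` of an `S`-module `L`, the first map being
given by the matrix `A`. (Finite free modules with fixed bases are identified with `S^r`.) -/
structure Presentation (S : Type*) [CommRing S] (L : Type*) [AddCommGroup L] [Module S L] where
  (r₁ r₀ : ℕ)
  A : Matrix (Fin r₀) (Fin r₁) S
  π : (Fin r₀ → S) →ₗ[S] L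
  exact : Function.Exact A.mulVecLin π
  surjective : Function.Surjective π

/-- A lift of a homomorphism `v : L → M` to finite free presentations of `L` and `M`:
matrices `V₁`, `V₀` of maps `v₁`, `v₀` which make the diagram with `v` commute. -/
structure Lift {S : Type*} [CommRing S] {L M : Type*} [AddCommGroup L] [Module S L]
    [AddCommGroup M] [Module S M] (p : Presentation S L) (q : Presentation S M)
    (v : L →ₗ[S] M) where
  V₁ : Matrix (Fin q.r₁) (Fin p.r₁) S
  V₀ : Matrix (Fin q.r₀) (Fin p.r₀) S
  comm₁ : q.A * V₁ = V₀ * p.A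
  comm₀ : q.π ∘ₗ V₀.mulVecLin = v ∘ₗ p.π

section

variable {k K : Type*} [Field k] [Field K] [Algebra k K] {m n : ℕ}

/-- The specialization `L_α = Coker φ_α` of `L` with respect to the presentation `p`, where
`φ` is the first map of `p`. -/
abbrev ModuleSpec {P : Ideal (R k m n)} [P.IsPrime] {L : Type*} [AddCommGroup L]
    [Module (Localization.AtPrime P) L] (p : Presentation (Localization.AtPrime P) L)
    (α : Fin m → K) (w : Ideal (RSpec k n α)) [w.IsPrime] : Type _ :=
  (Fin p.r₀ → Localization.AtPrime w) ⧸ LinearMap.range (matrixSpec P α w p.A).mulVecLin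

/-- `v'` is the specialization `v_α : L_α → M_α` of `v : L → M`, computed from the lift `(v₁, v₀)`:
all matrices involved can be specialized at `α`, the specialized square
`ψ_α (v₁)_α = (v₀)_α φ_α` commutes, and `v'` is induced by `(v₀)_α` on the cokernels. -/
structure IsHomSpec {P : Ideal (R k m n)} [P.IsPrime] {L M : Type*} [AddCommGroup L]
    [Module (Localization.AtPrime P) L] [AddCommGroup M] [Module (Localization.AtPrime P) M]
    {p : Presentation (Localization.AtPrime P) L} {q : Presentation (Localization.AtPrime P) M}
    {v : L →ₗ[Localization.AtPrime P] M} (l : Lift p q v)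
    (α : Fin m → K) (w : Ideal (RSpec k n α)) [w.IsPrime]
    (v' : ModuleSpec p α w →ₗ[Localization.AtPrime w] ModuleSpec q α w) : Prop where
  defined_source : MatrixSpecDefined P α w p.A
  defined_target : MatrixSpecDefined P α w q.A
  defined₁ : MatrixSpecDefined P α w l.V₁
  defined₀ : MatrixSpecDefined P α w l.V₀
  comm₁ : matrixSpec P α w q.A * matrixSpec P α w l.V₁ =
    matrixSpec P α w l.V₀ * matrixSpec P α w p.A
  comm₀ : v' ∘ₗ (LinearMap.range (matrixSpec P α w p.A).mulVecLin).mkQ =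
    (LinearMap.range (matrixSpec P α w q.A).mulVecLin).mkQ ∘ₗ (matrixSpec P α w l.V₀).mulVecLin

end

end ModuleSpecialization

end

/-!
Write `D = k[u]`, `A = D[X]` and `p = P ∩ A`, so that `S = A_p`, and `R_α / P_α` is the base change of
`A / p` along `D → k(α)`. The proof rests on generic flatness: a finite `A`-module becomes flat over
`D` once a suitable nonzero `d ∈ D` is inverted. For `d(α) ≠ 0` its `Tor₁` against `k(α)` then
vanishes, and this is the only consequence that is used (`BaseChangeExactAway`). The property is
stable under extensions, so dévissage reduces it to the modules `A / I`. There it follows from a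
normal form modulo leading terms (`exists_normal_form`): the monomials that are not leading monomials
of elements of `I` are independent over `D` in `A / I` and generate it up to powers of the product
`d` of finitely many leading coefficients.

Applied to the cokernel of a matrix over `A`, this shows that an exact sequence of free `A`-modules
remains exact under `u ↦ α` for almost all `α` (`exists_exact_map`). One consequence is that `g ∉ p`
specializes to a nonzerodivisor `g_α` modulo `P_α`, which hence avoids all associated primes
(`generically_subst_notMem`); so every element of `S` specializes for almost all `α`. Another is that
generators of the kernel of a matrix over `S` specialize to generators of the kernel
(`exists_generic_kernel`).

Finally, exactness of `0 → L → M → N → 0` is equivalent to a few statements on the matrices of the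
presentations and lifts: the range of one matrix, or a coordinate projection of the kernel of one,
lies in the range of another (`Lift.injective_iff`, `Lift.exact_iff`, `Lift.surjective_iff`). Such
statements are witnessed by matrix identities over `S` once generators of the kernels are fixed, and
these identities specialize.
-/

noncomputable section

namespace ModuleSpecialization

open scoped TensorProduct MonomialOrder

/-! ### Reduction modulo leading terms over a domain -/

section StandardMonomials

variable {σ D : Type*} [Finite σ] [CommRing D] [IsDomain D] [IsNoetherianRing D]

/-- Dickson's lemma for the leading exponents of an ideal, obtained from the noetherianity of the
polynomial ring. -/
theorem exists_finset_degree_le (o : MonomialOrder σ) (I : Ideal (MvPolynomial σ D)) :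
    ∃ T : Finset (MvPolynomial σ D), (∀ b ∈ T, b ∈ I ∧ b ≠ 0) ∧
      ∀ f ∈ I, f ≠ 0 → ∃ b ∈ T, o.degree b ≤ o.degree f := by
  classical
  let E : Set (σ →₀ ℕ) := o.degree '' {f | f ∈ I ∧ f ≠ 0}
  obtain ⟨t, htE, ht⟩ := (Submodule.fg_span_iff_fg_span_finset_subset _).1
    (IsNoetherian.noetherian (Ideal.span ((fun s => monomial s (1 : D)) '' E)))
  have h : ∀ x : {x // x ∈ t}, ∃ b, (b ∈ I ∧ b ≠ 0) ∧ monomial (o.degree b) (1 : D) = x := by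
    rintro ⟨x, hx⟩
    obtain ⟨_, ⟨b, hb, rfl⟩, rfl⟩ := htE hx
    exact ⟨b, hb, rfl⟩
  choose b hb hbx using h
  refine ⟨Finset.univ.image b, by
    simpa using fun _ x hx h => h ▸ hb ⟨x, hx⟩, fun f hf hf0 => ?_⟩
  have hts : (t : Set (MvPolynomial σ D)) =
      (fun s => monomial s (1 : D)) '' Set.range (fun x => o.degree (b x)) := by
    rw [← Set.range_comp]
    ext x
    constructor
    · exact fun hx => ⟨⟨x, hx⟩, hbx _⟩
    · rintro ⟨y, rfl⟩
      simp [hbx]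
  have hm : monomial (o.degree f) (1 : D) ∈
      Ideal.span ((fun s => monomial s (1 : D)) '' Set.range (fun x => o.degree (b x))) := by
    have : monomial (o.degree f) (1 : D) ∈ Ideal.span ((fun s => monomial s (1 : D)) '' E) :=
      Ideal.subset_span ⟨_, ⟨f, ⟨hf, hf0⟩, rfl⟩, rfl⟩
    rw [← hts]
    exact ht.le this
  obtain ⟨_, ⟨x, rfl⟩, hx⟩ := mem_ideal_span_monomial_image.1 hm (o.degree f) (by simp)
  exact ⟨b x, by simp, hx⟩

/-- Generic normal forms: for the exponents `Δ` that are not leading exponents of elements of `I`,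
the polynomials supported on `Δ` are independent modulo `I`, and they span the quotient once a
single nonzero `d`, a product of leading coefficients, is inverted. -/
theorem exists_normal_form (I : Ideal (MvPolynomial σ D)) :
    ∃ (d : D) (Δ : Set (σ →₀ ℕ)), d ≠ 0 ∧ (∀ r ∈ restrictSupport D Δ, r ∈ I → r = 0) ∧
      ∀ f, ∃ e : ℕ, ∃ r ∈ restrictSupport D Δ, d ^ e • f - r ∈ I := by
  classical
  obtain ⟨_, o⟩ : ∃ _ : LinearOrder σ, Nonempty (MonomialOrder σ) := by
    let e := (Finite.equivFin σ)
    let l : LinearOrder σ := LinearOrder.lift' e e.injective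
    exact ⟨l, ⟨MonomialOrder.lex⟩⟩
  obtain ⟨o⟩ := o
  obtain ⟨T, hTI, hT⟩ := exists_finset_degree_le o I
  let Δ : Set (σ →₀ ℕ) := {s | ∀ f ∈ I, f ≠ 0 → o.degree f ≠ s}
  refine ⟨∏ b ∈ T, o.leadingCoeff b, Δ, ?_, ?_, ?_⟩
  · exact Finset.prod_ne_zero_iff.2 fun b hb => o.leadingCoeff_ne_zero_iff.2 (hTI b hb).2
  · intro r hr hrI
    by_contra h0
    exact hr (o.degree_mem_support h0) r hrI h0 rfl
  set d := ∏ b ∈ T, o.leadingCoeff b with hd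
  suffices H : ∀ (a : o.syn) (f : MvPolynomial σ D), o.toSyn (o.degree f) = a →
      ∃ e : ℕ, ∃ r ∈ restrictSupport D Δ, d ^ e • f - r ∈ I from fun f => H _ f rfl
  intro a
  induction a using WellFoundedLT.induction with
  | ind a ih =>
  intro f hfa
  by_cases hf : f = 0
  · exact ⟨0, 0, Submodule.zero_mem _, by simp [hf]⟩
  -- the inductive hypothesis applies once the leading monomial of `f` has been cancelled
  have key : ∀ f₁ : MvPolynomial σ D, (∀ c ∈ f₁.support, o.toSyn c ≤ o.toSyn (o.degree f)) →
      f₁.coeff (o.degree f) = 0 → ∃ e : ℕ, ∃ r ∈ restrictSupport D Δ, d ^ e • f₁ - r ∈ I := by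
    intro f₁ h1 h2
    by_cases h0 : f₁ = 0
    · exact ⟨0, 0, Submodule.zero_mem _, by simp [h0]⟩
    refine ih _ ?_ f₁ rfl
    rw [← hfa]
    refine lt_of_le_of_ne (h1 _ (o.degree_mem_support h0)) fun h => ?_
    have h3 := o.degree_mem_support h0
    rw [o.toSyn.injective h] at h3
    exact (mem_support_iff.1 h3) h2
  by_cases hΔ : o.degree f ∈ Δ
  · obtain ⟨e, r, hr, her⟩ := key (f - monomial (o.degree f) (o.leadingCoeff f)) (by
      intro c hc
      rcases Finset.mem_union.1 (support_sub _ _ _ hc) with h | h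
      · exact o.le_degree h
      · rw [Finset.mem_singleton.1 (support_monomial_subset h)]) (by
      simp [MonomialOrder.leadingCoeff])
    refine ⟨e, r + d ^ e • monomial (o.degree f) (o.leadingCoeff f),
      Submodule.add_mem _ hr
        (Submodule.smul_mem _ _ ((monomial_mem_restrictSupport D).2 (Or.inl hΔ))),
      ?_⟩
    convert! her using 1
    rw [smul_sub]
    ring
  · obtain ⟨f', hf'I, hf'0, hf'⟩ : ∃ f' ∈ I, f' ≠ 0 ∧ o.degree f' = o.degree f := by
      simpa [Δ] using hΔ
    obtain ⟨b, hbT, hb⟩ := hT f' hf'I hf'0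
    rw [hf'] at hb
    obtain ⟨c, hc⟩ : o.leadingCoeff b ∣ d := Finset.dvd_prod_of_mem _ hbT
    set q := monomial (o.degree f - o.degree b) (c * o.leadingCoeff f) with hq
    obtain ⟨e, r, hr, her⟩ := key (d • f - q * b) (by
      have h1 : o.toSyn (o.degree (d • f)) ≤ o.toSyn (o.degree f) := o.degree_smul_le
      have h2 : o.toSyn (o.degree (q * b)) ≤ o.toSyn (o.degree f) := by
        refine o.degree_mul_le.trans ?_
        calc o.toSyn (o.degree q + o.degree b)
            ≤ o.toSyn (o.degree f - o.degree b + o.degree b) := by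
              rw [map_add, map_add]
              gcongr
              exact o.degree_monomial_le _
          _ = _ := by rw [tsub_add_cancel_of_le hb]
      intro x hx
      exact (o.le_degree hx).trans (o.degree_sub_le.trans (sup_le h1 h2))) (by
      have : coeff (o.degree f) (q * b) = c * o.leadingCoeff f * o.leadingCoeff b := by
        conv_lhs => rw [← tsub_add_cancel_of_le hb, hq, coeff_monomial_mul]
        rfl
      rw [coeff_sub, this, coeff_smul, hc, smul_eq_mul, MonomialOrder.leadingCoeff,
        MonomialOrder.leadingCoeff]
      ring)
    refine ⟨e + 1, r, hr, ?_⟩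
    have : d ^ (e + 1) • f - r = (d ^ e • (d • f - q * b) - r) + (d ^ e • q) * b := by
      rw [smul_sub, smul_smul, pow_succ, smul_mul_assoc]
      ring
    rw [this]
    exact I.add_mem her (I.mul_mem_left _ (hTI b hbT).1)

end StandardMonomials

/-! ### Generic vanishing of Tor -/

section

universe u v

/-- A module `M` over `D` such that every short exact sequence `0 → N' → N → M → 0` remains exact
on the left after base change to a `D`-algebra `B` in which `d` is invertible; in other words,
`Tor₁(B, M) = 0`. -/
def BaseChangeExactAway {D : Type u} [CommRing D] (d : D) (M : Type u) [AddCommGroup M]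
    [Module D M] : Prop :=
  ∀ (B : Type v) [CommRing B] [Algebra D B], IsUnit (algebraMap D B d) →
    ∀ (N' N : Type u) [AddCommGroup N'] [AddCommGroup N] [Module D N'] [Module D N]
      (g : N' →ₗ[D] N) (f : N →ₗ[D] M), Function.Injective g → Function.Exact g f →
      Function.Surjective f → Function.Injective (g.lTensor B)

variable {D : Type u} [CommRing D]

theorem BaseChangeExactAway.of_dvd {d d' : D} (h : d ∣ d') {M : Type u} [AddCommGroup M]
    [Module D M] (hM : BaseChangeExactAway.{u, v} d M) : BaseChangeExactAway.{u, v} d' M :=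
  fun B _ _ hd => hM B (isUnit_of_dvd_unit (map_dvd _ h) hd)

/-- The preimage of `M₁` in `N` factors `N' → N` into two maps with cokernels `M₁` and `M₃`. -/
theorem BaseChangeExactAway.of_exact {d : D} {M₁ M₂ M₃ : Type u} [AddCommGroup M₁]
    [AddCommGroup M₂] [AddCommGroup M₃] [Module D M₁] [Module D M₂] [Module D M₃]
    (i : M₁ →ₗ[D] M₂) (p : M₂ →ₗ[D] M₃) (hi : Function.Injective i) (hp : Function.Surjective p)
    (hip : Function.Exact i p) (h₁ : BaseChangeExactAway.{u, v} d M₁)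
    (h₃ : BaseChangeExactAway.{u, v} d M₃) : BaseChangeExactAway.{u, v} d M₂ := by
  intro B _ _ hd N' N _ _ _ _ g f hg hgf hf
  let N₁ := LinearMap.ker (p ∘ₗ f)
  have hN₁ : ∀ x : N₁, f x ∈ LinearMap.range i := fun x => (hip _).1 x.2
  let e := LinearEquiv.ofInjective i hi
  let f₁ : N₁ →ₗ[D] M₁ := e.symm.toLinearMap ∘ₗ (f ∘ₗ N₁.subtype).codRestrict _ hN₁
  have hf₁ : ∀ x : N₁, i (f₁ x) = f x := fun x =>
    congrArg Subtype.val (e.apply_symm_apply ⟨f x, hN₁ x⟩)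
  let g₁ : N' →ₗ[D] N₁ := g.codRestrict N₁ fun x => by simp [N₁, hgf.apply_apply_eq_zero]
  have hcomp : g = N₁.subtype ∘ₗ g₁ := rfl
  rw [hcomp, LinearMap.lTensor_comp, LinearMap.coe_comp]
  refine Function.Injective.comp (h₃ B hd _ _ _ (p ∘ₗ f) N₁.injective_subtype
    (LinearMap.exact_subtype_ker_map _) (hp.comp hf)) (h₁ B hd _ _ g₁ f₁ ?_ ?_ ?_)
  · exact fun x y h => hg (congrArg Subtype.val h)
  · intro x
    rw [← map_eq_zero_iff i hi, hf₁, hgf]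
    exact ⟨fun ⟨y, hy⟩ => ⟨y, Subtype.ext hy⟩, fun ⟨y, hy⟩ => ⟨y, congrArg Subtype.val hy⟩⟩
  · intro y
    obtain ⟨x, hx⟩ := hf (i y)
    refine ⟨⟨x, by simp [N₁, hx, hip.apply_apply_eq_zero]⟩, hi ?_⟩
    rw [hf₁, hx]

/-- A submodule with `s`-torsion cokernel has the same localization at `s` as the whole module. -/
theorem isLocalizedModule_comp_of_injective (s : Submonoid D) {Q N N₀ : Type*} [AddCommGroup Q]
    [AddCommGroup N] [AddCommGroup N₀] [Module D Q] [Module D N] [Module D N₀] (h : Q →ₗ[D] N)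
    (l : N →ₗ[D] N₀) [IsLocalizedModule s l] (hh : Function.Injective h)
    (hc : ∀ x : N, ∃ c : s, ∃ y, c • x = h y) : IsLocalizedModule s (l ∘ₗ h) where
  map_units := IsLocalizedModule.map_units l
  surj z := by
    obtain ⟨⟨x, c⟩, hx⟩ := IsLocalizedModule.surj s l z
    obtain ⟨c', y, hy⟩ := hc x
    refine ⟨⟨y, c' * c⟩, ?_⟩
    rw [mul_smul, hx, LinearMap.comp_apply, ← hy, LinearMap.map_smul_of_tower]
  exists_of_eq {x y} hxy := by
    obtain ⟨c, hc⟩ := IsLocalizedModule.exists_of_eq (S := s) (f := l) hxy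
    refine ⟨c, hh ?_⟩
    simpa using hc

theorem isUnit_algebraMap_end {B : Type*} [CommRing B] [Algebra D B] {c : D}
    (hc : IsUnit (algebraMap D B c)) (V : Type*) [AddCommGroup V] [Module D V] [Module B V]
    [IsScalarTower D B V] : IsUnit (algebraMap D (Module.End D V) c) := by
  rw [← (Algebra.lsmul D (A := B) D V).commutes]
  exact hc.map _

/-- An injection whose cokernel is `d`-power torsion stays injective after base change to an
algebra in which `d` is invertible: it does not affect the localization away from `d`. -/
theorem lTensor_injective_of_torsion {d : D} {Q N : Type*} [AddCommGroup Q]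
    [AddCommGroup N] [Module D Q] [Module D N] (h : Q →ₗ[D] N) (hh : Function.Injective h)
    (hc : ∀ x : N, ∃ (e : ℕ) (y : Q), d ^ e • x = h y) (B : Type*) [CommRing B] [Algebra D B]
    (hd : IsUnit (algebraMap D B d)) : Function.Injective (h.lTensor B) := by
  let s := Submonoid.powers d
  have hu : ∀ c : s, IsUnit (algebraMap D B c) := by
    rintro ⟨_, e, rfl⟩
    simpa using hd.pow e
  have hB : IsLocalizedModule s (LinearMap.id : B →ₗ[D] B) :=
    { map_units := fun c => isUnit_algebraMap_end (hu c) B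
      surj := fun z => ⟨(z, 1), one_smul _ _⟩
      exists_of_eq := fun h => ⟨1, by simpa using h⟩ }
  let l := LocalizedModule.mkLinearMap s N
  have hl : IsLocalizedModule s (l ∘ₗ h) := by
    refine isLocalizedModule_comp_of_injective s h l hh fun x => ?_
    obtain ⟨e, y, hy⟩ := hc x
    exact ⟨⟨d ^ e, e, rfl⟩, y, hy⟩
  have hT : IsLocalizedModule s (TensorProduct.map (LinearMap.id : B →ₗ[D] B) (l ∘ₗ h)) :=
    inferInstance
  intro x y hxy
  have hxy' : TensorProduct.map (LinearMap.id : B →ₗ[D] B) (l ∘ₗ h) x =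
      TensorProduct.map (LinearMap.id : B →ₗ[D] B) (l ∘ₗ h) y := by
    change (l ∘ₗ h).lTensor B x = (l ∘ₗ h).lTensor B y
    rw [LinearMap.lTensor_comp, LinearMap.comp_apply, hxy, LinearMap.comp_apply]
  obtain ⟨c, hc⟩ := IsLocalizedModule.exists_of_eq (S := s) hxy'
  have := (Module.End.isUnit_iff _).1 (isUnit_algebraMap_end (hu c) (B ⊗[D] Q))
  exact this.1 hc

/-- A module containing a free module with `d`-power torsion cokernel behaves like a free module
once `d` is inverted. -/
theorem BaseChangeExactAway.of_free {d : D} {F M : Type u} [AddCommGroup F] [AddCommGroup M]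
    [Module D F] [Module D M] [Module.Free D F] (φ : F →ₗ[D] M) (hφ : Function.Injective φ)
    (hc : ∀ x : M, ∃ (e : ℕ) (y : F), d ^ e • x = φ y) : BaseChangeExactAway.{u, v} d M := by
  intro B _ _ hd N' N _ _ _ _ g f hg hgf hf
  obtain ⟨s, hs⟩ := Module.projective_lifting_property f φ hf
  have hs' : ∀ x, f (s x) = φ x := fun x => LinearMap.congr_fun hs x
  have hinj := lTensor_injective_of_torsion (d := d) (g.coprod s) (by
    rw [← LinearMap.ker_eq_bot, LinearMap.ker_eq_bot']
    rintro ⟨x, y⟩ hxy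
    have hy : y = 0 := by
      apply hφ
      have := congrArg f hxy
      simpa [hgf.apply_apply_eq_zero, hs'] using this
    subst hy
    simpa [map_eq_zero_iff g hg] using hxy) (by
    intro x
    obtain ⟨e, y, hy⟩ := hc (f x)
    obtain ⟨z, hz⟩ := (hgf (d ^ e • x - s y)).1 (by simp [hs', hy])
    exact ⟨e, (z, y), by simp [hz]⟩) B hd
  have hcomp : g = g.coprod s ∘ₗ LinearMap.inl D N' F := by simp
  rw [hcomp, LinearMap.lTensor_comp, LinearMap.coe_comp]
  refine hinj.comp (Function.LeftInverse.injective (g := (LinearMap.fst D N' F).lTensor B) ?_)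
  intro x
  rw [← LinearMap.comp_apply, ← LinearMap.lTensor_comp]
  simp

/-- A form of Grothendieck's generic flatness: dévissage reduces it to the quotients of the
polynomial ring by prime ideals, which become free after inverting a single element. -/
theorem exists_baseChangeExactAway {σ : Type} [Finite σ] [IsDomain D] [IsNoetherianRing D]
    (M : Type u) [AddCommGroup M] [Module (MvPolynomial σ D) M] [Module.Finite (MvPolynomial σ D) M]
    [Module D M] [IsScalarTower D (MvPolynomial σ D) M] :
    ∃ d : D, d ≠ 0 ∧ BaseChangeExactAway.{u, v} d M := by
  have key : ∃ d : D, d ≠ 0 ∧ ∀ [Module D M] [IsScalarTower D (MvPolynomial σ D) M],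
      BaseChangeExactAway.{u, v} d M := by
    refine IsNoetherianRing.induction_on_isQuotientEquivQuotientPrime (MvPolynomial σ D)
      (motive := fun N _ _ _ => ∃ d : D, d ≠ 0 ∧ ∀ [Module D N]
        [IsScalarTower D (MvPolynomial σ D) N], BaseChangeExactAway.{u, v} d N) ‹_› ?_ ?_ ?_
    · intro N _ _ _ _
      refine ⟨1, one_ne_zero, fun {_ _} => ?_⟩
      exact .of_free (F := PUnit.{u + 1}) 0 (Function.injective_of_subsingleton _)
        fun x => ⟨0, 0, Subsingleton.elim _ _⟩
    · intro N _ _ _ p e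
      obtain ⟨d, Δ, hd, hΔ, hspan⟩ := exists_normal_form p.1
      refine ⟨d, hd, fun {_ _} => ?_⟩
      have : Module.Free D (restrictSupport D Δ) := .of_basis (basisRestrictSupport D Δ)
      let e' := e.symm.restrictScalars D
      let φ : restrictSupport D Δ →ₗ[D] N := e'.toLinearMap ∘ₗ
        (Ideal.Quotient.mkₐ D p.1).toLinearMap ∘ₗ (restrictSupport D Δ).subtype
      refine .of_free φ ?_ ?_
      · rw [← LinearMap.ker_eq_bot, LinearMap.ker_eq_bot']
        intro r hr
        have : Ideal.Quotient.mk p.1 r = 0 := by simpa [φ] using hr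
        exact Subtype.ext (hΔ r r.2 (Ideal.Quotient.eq_zero_iff_mem.1 this))
      · intro x
        obtain ⟨f, hf⟩ := Ideal.Quotient.mk_surjective (e x)
        obtain ⟨n, r, hr, hfr⟩ := hspan f
        refine ⟨n, ⟨r, hr⟩, e'.symm.injective ?_⟩
        have h1 : Ideal.Quotient.mkₐ D p.1 (d ^ n • f) = Ideal.Quotient.mkₐ D p.1 r :=
          Ideal.Quotient.eq.2 hfr
        rw [map_smul] at h1
        simp only [map_smul, φ, LinearMap.comp_apply, LinearEquiv.coe_coe,
          LinearEquiv.symm_apply_apply]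
        refine Eq.trans ?_ h1
        exact congrArg (d ^ n • ·) hf.symm
    · intro N₁ _ _ _ N₂ _ _ _ N₃ _ _ _ i p hi hp hip ⟨d₁, h₁, H₁⟩ ⟨d₃, h₃, H₃⟩
      refine ⟨d₁ * d₃, mul_ne_zero h₁ h₃, fun {_ _} => ?_⟩
      let : Module D N₁ := Module.compHom N₁ (algebraMap D (MvPolynomial σ D))
      have : IsScalarTower D (MvPolynomial σ D) N₁ := .of_algebraMap_smul fun _ _ => rfl
      let : Module D N₃ := Module.compHom N₃ (algebraMap D (MvPolynomial σ D))
      have : IsScalarTower D (MvPolynomial σ D) N₃ := .of_algebraMap_smul fun _ _ => rfl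
      exact .of_exact (i.restrictScalars D) (p.restrictScalars D) hi hp hip
        (.of_dvd (Dvd.intro _ rfl) H₁) (.of_dvd (Dvd.intro_left _ rfl) H₃)
  obtain ⟨d, hd, H⟩ := key
  exact ⟨d, hd, H⟩

end

/-! ### Specializing exact sequences of matrices -/

section

universe u v

/-- Exactness after tensoring with `B`, transported along identifications of the base changes. -/
theorem exact_of_isBaseChange {R B : Type*} [CommRing R] [CommRing B] [Algebra R B]
    {M₁ M₂ M₃ M₁' M₂' M₃' : Type*} [AddCommGroup M₁] [AddCommGroup M₂] [AddCommGroup M₃]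
    [AddCommGroup M₁'] [AddCommGroup M₂'] [AddCommGroup M₃'] [Module R M₁] [Module R M₂]
    [Module R M₃] [Module R M₁'] [Module R M₂'] [Module R M₃'] [Module B M₁'] [Module B M₂']
    [Module B M₃'] [IsScalarTower R B M₁'] [IsScalarTower R B M₂'] [IsScalarTower R B M₃']
    {f : M₁ →ₗ[R] M₂} {g : M₂ →ₗ[R] M₃} {f' : M₁' →ₗ[B] M₂'} {g' : M₂' →ₗ[B] M₃'}
    {h₁ : M₁ →ₗ[R] M₁'} {h₂ : M₂ →ₗ[R] M₂'} {h₃ : M₃ →ₗ[R] M₃'} (H₁ : IsBaseChange B h₁)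
    (H₂ : IsBaseChange B h₂) (H₃ : IsBaseChange B h₃) (hf : ∀ x, f' (h₁ x) = h₂ (f x))
    (hg : ∀ x, g' (h₂ x) = h₃ (g x)) (H : Function.Exact (f.lTensor B) (g.lTensor B)) :
    Function.Exact f' g' := by
  have hf' : (f'.restrictScalars R) ∘ₗ (H₁.equiv.restrictScalars R).toLinearMap =
      (H₂.equiv.restrictScalars R).toLinearMap ∘ₗ f.lTensor B := by
    ext b x
    simp [IsBaseChange.equiv_tmul, hf]
  have hg' : (g'.restrictScalars R) ∘ₗ (H₂.equiv.restrictScalars R).toLinearMap =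
      (H₃.equiv.restrictScalars R).toLinearMap ∘ₗ g.lTensor B := by
    ext b x
    simp [IsBaseChange.equiv_tmul, hg]
  exact Function.Exact.of_ladder_linearEquiv_of_exact (f₁₂ := f.lTensor B) (f₂₃ := g.lTensor B)
    (g₁₂ := f'.restrictScalars R) (g₂₃ := g'.restrictScalars R)
    (e₁ := H₁.equiv.restrictScalars R) (e₂ := H₂.equiv.restrictScalars R)
    (e₃ := H₃.equiv.restrictScalars R) hf' hg' H

variable {D : Type u} [CommRing D]

/-- Base change of coefficients of polynomials, as a linear map. -/
def mapLinear (σ D B : Type*) [CommRing D] [CommRing B] [Algebra D B] :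
    MvPolynomial σ D →ₗ[D] MvPolynomial σ B where
  toFun := map (algebraMap D B)
  map_add' := map_add _
  map_smul' c x := by simp [Algebra.smul_def, MvPolynomial.algebraMap_apply]

theorem mapLinear_apply {σ B : Type*} [CommRing B] [Algebra D B] (x : MvPolynomial σ D) :
    mapLinear σ D B x = map (algebraMap D B) x := rfl

theorem isBaseChange_mapLinear (σ B : Type*) [CommRing B] [Algebra D B] :
    IsBaseChange B (mapLinear σ D B) :=
  .of_equiv (algebraTensorAlgEquiv D B).toLinearEquiv fun _ => by simp [mapLinear_apply]

theorem lTensor_exact_of_injective {M₁ M₂ M₃ : Type*} [AddCommGroup M₁] [AddCommGroup M₂]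
    [AddCommGroup M₃] [Module D M₁] [Module D M₂] [Module D M₃] (f : M₁ →ₗ[D] M₂)
    (g : M₂ →ₗ[D] M₃) (h : Function.Exact f g) (B : Type*) [AddCommGroup B] [Module D B]
    (hg : Function.Injective ((LinearMap.range g).subtype.lTensor B)) :
    Function.Exact (f.lTensor B) (g.lTensor B) := by
  have hr : Function.Exact f g.rangeRestrict := fun x => Subtype.ext_iff.trans (h x)
  have hcomp : g = (LinearMap.range g).subtype ∘ₗ g.rangeRestrict := rfl
  have h2 := (lTensor_exact B hr g.surjective_rangeRestrict).comp_injective _ hg (map_zero _)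
  rw [hcomp, LinearMap.lTensor_comp]
  exact h2

/-- Exactness at `M₂` is inherited by base change as soon as `Tor₁` of the cokernel of `g`
vanishes. -/
theorem exists_exact_lTensor {σ : Type} [Finite σ] [IsDomain D] [IsNoetherianRing D]
    {M₁ M₂ M₃ : Type u} [AddCommGroup M₁] [AddCommGroup M₂] [AddCommGroup M₃]
    [Module (MvPolynomial σ D) M₁] [Module (MvPolynomial σ D) M₂] [Module (MvPolynomial σ D) M₃]
    [Module D M₁] [Module D M₂] [Module D M₃] [IsScalarTower D (MvPolynomial σ D) M₁]
    [IsScalarTower D (MvPolynomial σ D) M₂] [IsScalarTower D (MvPolynomial σ D) M₃]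
    [Module.Finite (MvPolynomial σ D) M₃] (f : M₁ →ₗ[MvPolynomial σ D] M₂)
    (g : M₂ →ₗ[MvPolynomial σ D] M₃) (h : Function.Exact f g) :
    ∃ d : D, d ≠ 0 ∧ ∀ (B : Type v) [CommRing B] [Algebra D B], IsUnit (algebraMap D B d) →
      Function.Exact ((f.restrictScalars D).lTensor B) ((g.restrictScalars D).lTensor B) := by
  obtain ⟨d, hd, H⟩ := exists_baseChangeExactAway.{u, v} (D := D) (σ := σ)
    (M₃ ⧸ LinearMap.range g)
  refine ⟨d, hd, fun B _ _ hu => lTensor_exact_of_injective (f.restrictScalars D)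
    (g.restrictScalars D) h B ?_⟩
  have e : Function.Exact (LinearMap.range (g.restrictScalars D)).subtype
      ((LinearMap.range g).mkQ.restrictScalars D) := by
    intro x
    simp only [LinearMap.coe_restrictScalars, Submodule.mkQ_apply, Submodule.Quotient.mk_eq_zero,
      Submodule.coe_subtype, Subtype.range_coe_subtype]
    rfl
  have i : Function.Injective (LinearMap.range (g.restrictScalars D)).subtype :=
    Subtype.val_injective
  have su : Function.Surjective ((LinearMap.range g).mkQ.restrictScalars D) :=
    Submodule.mkQ_surjective (LinearMap.range g)
  exact H B hu _ _ _ _ i e su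

/-- Exactness of a complex of free modules over `D[X]` is inherited by its specializations along
all `ψ : D → B` which invert a suitable nonzero `d`: choose `d` so that `Tor₁(B, C) = 0` for the
cokernel `C` of the last map. -/
theorem exists_exact_map {σ : Type} [Finite σ] [IsDomain D] [IsNoetherianRing D]
    {ι κ l : Type} [Fintype ι] [Fintype κ] [Fintype l]
    (Y : Matrix κ ι (MvPolynomial σ D)) (T : Matrix l κ (MvPolynomial σ D))
    (h : Function.Exact Y.mulVecLin T.mulVecLin) :
    ∃ d : D, d ≠ 0 ∧ ∀ (B : Type v) [CommRing B] (ψ : D →+* B), IsUnit (ψ d) →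
      Function.Exact (Y.map (map ψ)).mulVecLin (T.map (map ψ)).mulVecLin := by
  obtain ⟨d, hd, H⟩ := exists_exact_lTensor.{u, v} (D := D) (σ := σ) Y.mulVecLin T.mulVecLin h
  refine ⟨d, hd, fun B _ ψ hu => ?_⟩
  let := ψ.toAlgebra
  have hT := H B hu
  have hbc (ι : Type) [Fintype ι] :=
    (isBaseChange_mapLinear (D := D) σ B).finitePow (ι := ι)
  refine exact_of_isBaseChange (R := D) (f := Y.mulVecLin.restrictScalars D)
    (g := T.mulVecLin.restrictScalars D)
    (f' := (Y.map (map ψ)).mulVecLin.restrictScalars B)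
    (g' := (T.map (map ψ)).mulVecLin.restrictScalars B) (hbc ι) (hbc κ) (hbc l) ?_ ?_ hT
  · intro x
    ext i
    simp [Matrix.mulVec, dotProduct, mapLinear_apply, ψ.algebraMap_toAlgebra]
  · intro x
    ext i
    simp [Matrix.mulVec, dotProduct, mapLinear_apply, ψ.algebraMap_toAlgebra]

theorem exact_map_localization {R B : Type*} [CommRing R] [CommRing B] [Algebra R B]
    (s : Submonoid R) [IsLocalization s B] {ι κ l : Type} [Fintype ι] [Fintype κ] [Fintype l]
    (Y : Matrix κ ι R) (T : Matrix l κ R) (h : Function.Exact Y.mulVecLin T.mulVecLin) :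
    Function.Exact (Y.map (algebraMap R B)).mulVecLin (T.map (algebraMap R B)).mulVecLin := by
  have := IsLocalization.flat B s
  have hbc (ι : Type) [Fintype ι] := (IsBaseChange.linearMap R B).finitePow (ι := ι)
  refine exact_of_isBaseChange (f := Y.mulVecLin) (g := T.mulVecLin) (hbc ι) (hbc κ) (hbc l)
    ?_ ?_ (Module.Flat.lTensor_exact B h)
  · intro x
    ext i
    simp [Matrix.mulVec, dotProduct]
  · intro x
    ext i
    simp [Matrix.mulVec, dotProduct]

theorem exists_exact_matrix {R : Type*} [CommRing R] [IsNoetherianRing R] {κ l : Type*} [Fintype κ]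
    [Fintype l] (T : Matrix l κ R) :
    ∃ (q : ℕ) (Y : Matrix κ (Fin q) R), Function.Exact Y.mulVecLin T.mulVecLin := by
  obtain ⟨q, y, hy⟩ := Submodule.fg_iff_exists_fin_generating_family.1
    (IsNoetherian.noetherian (LinearMap.ker T.mulVecLin))
  refine ⟨q, Matrix.of fun i j => y j i, LinearMap.exact_iff.2 ?_⟩
  rw [← hy, Matrix.range_mulVecLin]
  rfl

/-- If `g` is a nonzerodivisor modulo `p`, then it remains one after generic specialization: the
coefficients of `g` in the relations between `g` and the generators of `p` lie in `p`, and these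
relations specialize. -/
theorem exists_mem_map_of_mul_mem {σ : Type} [Finite σ] [IsDomain D] [IsNoetherianRing D]
    (p : Ideal (MvPolynomial σ D)) (g : MvPolynomial σ D) (hg : ∀ y, g * y ∈ p → y ∈ p) :
    ∃ d : D, d ≠ 0 ∧ ∀ (B : Type v) [CommRing B] (ψ : D →+* B), IsUnit (ψ d) →
      ∀ x, map ψ g * x ∈ p.map (map ψ) → x ∈ p.map (map ψ) := by
  obtain ⟨r, f, hf⟩ := Submodule.fg_iff_exists_fin_generating_family.1
    (IsNoetherian.noetherian p)
  let T : Matrix Unit (Unit ⊕ Fin r) (MvPolynomial σ D) :=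
    Matrix.of fun _ => Sum.elim (fun _ => g) f
  obtain ⟨q, Y, hY⟩ := exists_exact_matrix T
  obtain ⟨d, hd, H⟩ := exists_exact_map.{u, v} Y T hY
  refine ⟨d, hd, fun B _ ψ hu x hx => ?_⟩
  have hYp : ∀ j, Y (Sum.inl ()) j ∈ p := by
    intro j
    have h0 := congrFun (hY.apply_apply_eq_zero (Pi.single j 1)) ()
    rw [Matrix.mulVecLin_apply, Matrix.mulVecLin_apply, Matrix.mulVec_single_one] at h0
    have h1 : g * Y (Sum.inl ()) j + ∑ i, f i * Y (Sum.inr i) j = 0 := by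
      simpa [Matrix.mulVec, dotProduct, T] using h0
    refine hg _ ?_
    rw [eq_neg_of_add_eq_zero_left h1]
    refine p.neg_mem (p.sum_mem fun i _ => p.mul_mem_right _ ?_)
    rw [← hf]
    exact Submodule.subset_span ⟨i, rfl⟩
  have hp : p.map (map ψ) = Ideal.span (Set.range fun i => map ψ (f i)) := by
    conv_lhs => rw [← hf]
    erw [Ideal.map_span]
    rw [← Set.range_comp]
    rfl
  rw [hp, Ideal.mem_span_range_iff_exists_fun] at hx
  obtain ⟨c, hc⟩ := hx
  obtain ⟨z, hz⟩ := (H B ψ hu (Sum.elim (fun _ => x) (fun i => -c i))).1 (by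
    ext1 ⟨⟩
    simp only [mul_comm (c _)] at hc
    simp [Matrix.mulVec, dotProduct, T, hc])
  have hz' := congrFun hz (Sum.inl ())
  simp only [Matrix.mulVecLin_apply, Matrix.mulVec, dotProduct, Sum.elim_inl] at hz'
  rw [← hz']
  exact Ideal.sum_mem _ fun j _ => Ideal.mul_mem_right _ _ (Ideal.mem_map_of_mem _ (hYp j))

end

/-! ### The ring of elements of `S` that specialize -/

section

variable {k K : Type*} [Field k] [Field K] [Algebra k K] {m n : ℕ}

theorem IsPolySpec.of_incl (α : Fin m → K) (p : MvPolynomial (Fin n) (MvPolynomial (Fin m) k)) :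
    IsPolySpec α (incl k m n p) (subst k n α p) :=
  ⟨p, 1, by simp, by simp, by simp⟩

theorem IsPolySpec.mul {α : Fin m → K} {f g : R k m n} {f' g' : RSpec k n α}
    (hf : IsPolySpec α f f') (hg : IsPolySpec α g g') : IsPolySpec α (f * g) (f' * g') := by
  obtain ⟨p₁, q₁, z₁, e₁, s₁⟩ := hf
  obtain ⟨p₂, q₂, z₂, e₂, s₂⟩ := hg
  refine ⟨p₁ * p₂, q₁ * q₂, by simp [z₁, z₂], ?_, ?_⟩
  · rw [map_mul, map_mul, map_mul, ← e₁, ← e₂]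
    ring
  · rw [map_mul, map_mul, map_mul, ← s₁, ← s₂]
    ring

theorem IsPolySpec.add {α : Fin m → K} {f g : R k m n} {f' g' : RSpec k n α}
    (hf : IsPolySpec α f f') (hg : IsPolySpec α g g') : IsPolySpec α (f + g) (f' + g') := by
  obtain ⟨p₁, q₁, z₁, e₁, s₁⟩ := hf
  obtain ⟨p₂, q₂, z₂, e₂, s₂⟩ := hg
  refine ⟨C q₂ * p₁ + C q₁ * p₂, q₁ * q₂, by simp [z₁, z₂], ?_, ?_⟩
  · rw [map_mul, map_mul, map_add, map_mul, map_mul, ← e₁, ← e₂]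
    ring
  · rw [map_mul, map_mul, map_add, map_mul, map_mul, ← s₁, ← s₂]
    ring

variable {P : Ideal (R k m n)} [P.IsPrime] {α : Fin m → K} {w : Ideal (RSpec k n α)} [w.IsPrime]

variable (P w) in
theorem IsElemSpec.of_incl (p : MvPolynomial (Fin n) (MvPolynomial (Fin m) k)) :
    IsElemSpec P α w (algebraMap _ _ (incl k m n p)) (algebraMap _ _ (subst k n α p)) :=
  ⟨incl k m n p, 1, subst k n α p, 1, P.one_notMem, w.one_notMem, .of_incl α p,
    by simpa using IsPolySpec.of_incl (k := k) (n := n) α 1, by simp, by simp⟩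

theorem IsElemSpec.mul {a b : Localization.AtPrime P} {a' b' : Localization.AtPrime w}
    (ha : IsElemSpec P α w a a') (hb : IsElemSpec P α w b b') :
    IsElemSpec P α w (a * b) (a' * b') := by
  obtain ⟨f₁, g₁, f₁', g₁', hP₁, hw₁, hf₁, hg₁, e₁, s₁⟩ := ha
  obtain ⟨f₂, g₂, f₂', g₂', hP₂, hw₂, hf₂, hg₂, e₂, s₂⟩ := hb
  refine ⟨f₁ * f₂, g₁ * g₂, f₁' * f₂', g₁' * g₂', ‹P.IsPrime›.mul_notMem hP₁ hP₂,
    ‹w.IsPrime›.mul_notMem hw₁ hw₂, hf₁.mul hf₂, hg₁.mul hg₂, ?_, ?_⟩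
  · rw [map_mul, map_mul, ← e₁, ← e₂]
    ring
  · rw [map_mul, map_mul, ← s₁, ← s₂]
    ring

theorem IsElemSpec.add {a b : Localization.AtPrime P} {a' b' : Localization.AtPrime w}
    (ha : IsElemSpec P α w a a') (hb : IsElemSpec P α w b b') :
    IsElemSpec P α w (a + b) (a' + b') := by
  obtain ⟨f₁, g₁, f₁', g₁', hP₁, hw₁, hf₁, hg₁, e₁, s₁⟩ := ha
  obtain ⟨f₂, g₂, f₂', g₂', hP₂, hw₂, hf₂, hg₂, e₂, s₂⟩ := hb
  refine ⟨f₁ * g₂ + f₂ * g₁, g₁ * g₂, f₁' * g₂' + f₂' * g₁', g₁' * g₂',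
    ‹P.IsPrime›.mul_notMem hP₁ hP₂, ‹w.IsPrime›.mul_notMem hw₁ hw₂,
    (hf₁.mul hg₂).add (hf₂.mul hg₁), hg₁.mul hg₂, ?_, ?_⟩
  · rw [map_add, map_mul, map_mul, map_mul, ← e₁, ← e₂]
    ring
  · rw [map_add, map_mul, map_mul, map_mul, ← s₁, ← s₂]
    ring

variable (P w) in
theorem IsElemSpec.zero : IsElemSpec P α w 0 0 := by
  simpa using IsElemSpec.of_incl P w 0

variable (P w) in
theorem IsElemSpec.one : IsElemSpec P α w 1 1 := by
  simpa using IsElemSpec.of_incl P w 1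

variable (P w) in
/-- The subsemiring of those `a ∈ S` for which `a_α ∈ S_α` is defined. -/
def specSubsemiring : Subsemiring (Localization.AtPrime P) where
  carrier := {a | ∃ b, IsElemSpec P α w a b}
  mul_mem' := fun ⟨_, ha⟩ ⟨_, hb⟩ => ⟨_, ha.mul hb⟩
  add_mem' := fun ⟨_, ha⟩ ⟨_, hb⟩ => ⟨_, ha.add hb⟩
  zero_mem' := ⟨0, .zero P w⟩
  one_mem' := ⟨1, .one P w⟩

variable (P w) in
/-- Specialization `a ↦ a_α`, as a homomorphism on the elements for which it is defined. -/
def specHom : specSubsemiring P w →+* Localization.AtPrime w where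
  toFun a := elemSpec P α w a
  map_one' := (IsElemSpec.one P w).elemSpec_eq
  map_zero' := (IsElemSpec.zero P w).elemSpec_eq
  map_mul' := fun ⟨_, _, ha⟩ ⟨_, _, hb⟩ => by
    rw [ha.elemSpec_eq, hb.elemSpec_eq]
    exact (ha.mul hb).elemSpec_eq
  map_add' := fun ⟨_, _, ha⟩ ⟨_, _, hb⟩ => by
    rw [ha.elemSpec_eq, hb.elemSpec_eq]
    exact (ha.add hb).elemSpec_eq

theorem exists_map_subtype_eq {ι κ : Type*} {A : Matrix ι κ (Localization.AtPrime P)}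
    (hA : ∀ i j, A i j ∈ specSubsemiring P w) :
    ∃ A' : Matrix ι κ (specSubsemiring P w), A = A'.map (specSubsemiring P w).subtype ∧
      A.map (elemSpec P α w) = A'.map (specHom P w) :=
  ⟨Matrix.of fun i j => ⟨A i j, hA i j⟩, rfl, rfl⟩

theorem map_elemSpec_mul {ι κ l : Type*} [Fintype κ] {A : Matrix ι κ (Localization.AtPrime P)}
    {B : Matrix κ l (Localization.AtPrime P)} (hA : ∀ i j, A i j ∈ specSubsemiring P w)
    (hB : ∀ i j, B i j ∈ specSubsemiring P w) :
    (A * B).map (elemSpec P α w) = A.map (elemSpec P α w) * B.map (elemSpec P α w) := by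
  obtain ⟨A', rfl, hA'⟩ := exists_map_subtype_eq hA
  obtain ⟨B', rfl, hB'⟩ := exists_map_subtype_eq hB
  rw [hA', hB', ← Matrix.map_mul, ← Matrix.map_mul]
  rfl

theorem map_elemSpec_one {ι : Type*} [DecidableEq ι] :
    (1 : Matrix ι ι (Localization.AtPrime P)).map (elemSpec P α w) = 1 :=
  Matrix.map_one _ (IsElemSpec.zero P w).elemSpec_eq (IsElemSpec.one P w).elemSpec_eq

end

/-! ### Properties that hold generically -/

section

variable {k K : Type*} [Field k] [Field K] [Algebra k K] {m n : ℕ}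

/-- `p α w` holds for every `α` outside the zero set of some nonzero polynomial over `k` and for
every associated prime `w` of `P_α`. -/
def Generically (P : Ideal (R k m n))
    (p : ∀ (α : Fin m → K) (w : Ideal (RSpec k n α)) [w.IsPrime], Prop) : Prop :=
  ∃ d : MvPolynomial (Fin m) k, d ≠ 0 ∧ ∀ α : Fin m → K, substCoeff k α d ≠ 0 →
    ∀ (w : Ideal (RSpec k n α)) [w.IsPrime],
      w ∈ associatedPrimes (RSpec k n α) (RSpec k n α ⧸ idealSpec P α) → p α w

variable {P : Ideal (R k m n)}
  {p q : ∀ (α : Fin m → K) (w : Ideal (RSpec k n α)) [w.IsPrime], Prop}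

theorem Generically.mono (hp : Generically P p)
    (h : ∀ (α : Fin m → K) (w : Ideal (RSpec k n α)) [w.IsPrime], p α w → q α w) :
    Generically P q := by
  obtain ⟨d, hd, H⟩ := hp
  exact ⟨d, hd, fun α hα w _ hw => h α w (H α hα w hw)⟩

theorem Generically.forall {ι : Type*} [Finite ι]
    {p : ι → ∀ (α : Fin m → K) (w : Ideal (RSpec k n α)) [w.IsPrime], Prop}
    (h : ∀ i, Generically P (p i)) : Generically P fun α w _ => ∀ i, p i α w := by
  choose d hd H using h
  have := Fintype.ofFinite ι
  refine ⟨∏ i, d i, Finset.prod_ne_zero_iff.2 fun i _ => hd i, fun α hα w _ hw i => ?_⟩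
  rw [map_prod, Finset.prod_ne_zero_iff] at hα
  exact H i α (hα i (Finset.mem_univ i)) w hw

theorem Generically.and (hp : Generically P p) (hq : Generically P q) :
    Generically P fun α w _ => p α w ∧ q α w := by
  obtain ⟨d, hd, H⟩ := hp
  obtain ⟨e, he, H'⟩ := hq
  refine ⟨d * e, mul_ne_zero hd he, fun α hα w _ hw => ?_⟩
  rw [map_mul] at hα
  exact ⟨H α (left_ne_zero_of_mul hα) w hw, H' α (right_ne_zero_of_mul hα) w hw⟩

theorem coe_substCoeff (α : Fin m → K) (q : MvPolynomial (Fin m) k) :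
    (IntermediateField.adjoin k (Set.range α)).val (substCoeff k α q) = aeval α q := by
  change ((IntermediateField.adjoin k (Set.range α)).val.comp
    (aeval (AdjoinField.gen k α) : _ →ₐ[k] IntermediateField.adjoin k (Set.range α))) q = _
  congr 1
  ext i
  exact (congrArg Subtype.val (aeval_X (R := k) (AdjoinField.gen k α) i)).trans
    (by simp [AdjoinField.gen])

/-- Over an infinite field, the zero set of a nonzero polynomial is a proper subvariety. -/
theorem Generically.almostAll [Infinite K] (hp : Generically P p) :
    AlmostAll fun α : Fin m → K => ∀ (w : Ideal (RSpec k n α)) [w.IsPrime],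
      w ∈ associatedPrimes (RSpec k n α) (RSpec k n α ⧸ idealSpec P α) → p α w := by
  obtain ⟨d, hd, H⟩ := hp
  refine ⟨Ideal.span {map (algebraMap k K) d}, fun h => hd ?_, fun α hα => H α fun h0 => hα ?_⟩
  · refine map_injective _ (algebraMap k K).injective ?_
    rw [map_zero]
    refine funext fun α => ?_
    have hα := (h ▸ Set.mem_univ α : α ∈ zeroLocus K (Ideal.span {map (algebraMap k K) d}))
    simpa using (mem_zeroLocus_iff.1 hα) _ (Ideal.mem_span_singleton_self _)
  · rw [zeroLocus_span]
    rintro _ rfl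
    rw [aeval_map_algebraMap, ← coe_substCoeff, h0]
    rfl

variable [P.IsPrime]

/-- Denominators of elements of `S` remain denominators: `g` is a nonzerodivisor modulo `P`, so
generically `g_α` is one modulo `P_α` and lies in no associated prime. -/
theorem generically_subst_notMem {g : MvPolynomial (Fin n) (MvPolynomial (Fin m) k)}
    (hg : incl k m n g ∉ P) : Generically (K := K) P fun α w _ => subst k n α g ∉ w := by
  obtain ⟨d, hd, H⟩ := exists_mem_map_of_mul_mem (P.comap (incl k m n)) g (fun y hy => by
    rw [Ideal.mem_comap, map_mul] at hy
    exact (‹P.IsPrime›.mem_or_mem hy).resolve_left hg)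
  refine ⟨d, hd, fun α hα w _ hw hgw => ?_⟩
  obtain ⟨_, x, rfl⟩ := isAssociatedPrime_iff.1 (AssociatedPrimes.mem_iff.1 hw)
  obtain ⟨x, rfl⟩ := Ideal.Quotient.mk_surjective x
  have h1 := H (AdjoinField k α) (substCoeff k α) (isUnit_iff_ne_zero.2 hα) x (by
    have := Submodule.mem_colon_singleton.1 hgw
    rw [Submodule.mem_bot] at this
    exact Ideal.Quotient.eq_zero_iff_mem.1 this)
  refine ‹Ideal.IsPrime _›.ne_top ((Ideal.eq_top_iff_one _).2 ?_)
  rw [Submodule.mem_colon_singleton, one_smul, Submodule.mem_bot]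
  exact Ideal.Quotient.eq_zero_iff_mem.2 h1

variable (P) in
/-- Fractions of `S` have a common denominator in `k[u, X]`, as `S` is also a localization of that
ring. -/
theorem exists_common_denominator {ι : Type*} [Finite ι] (a : ι → Localization.AtPrime P) :
    ∃ (g : MvPolynomial (Fin n) (MvPolynomial (Fin m) k))
      (f : ι → MvPolynomial (Fin n) (MvPolynomial (Fin m) k)),
      incl k m n g ∉ P ∧ ∀ i, a i * algebraMap _ _ (incl k m n g) =
        algebraMap _ _ (incl k m n (f i)) := by
  let := algebraMvPolynomial (σ := Fin n) (R := MvPolynomial (Fin m) k)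
    (S := FractionRing (MvPolynomial (Fin m) k))
  have := IsLocalization.isLocalization_isLocalization_atPrime_isLocalization
    ((nonZeroDivisors (MvPolynomial (Fin m) k)).map (C (σ := Fin n)))
    (Localization.AtPrime P) P
  obtain ⟨b, hb⟩ := IsLocalization.exist_integer_multiples_of_finite
    (P.comap (algebraMap (MvPolynomial (Fin n) (MvPolynomial (Fin m) k)) (R k m n))).primeCompl a
  choose f hf using hb
  refine ⟨b, f, b.2, fun i => ?_⟩
  rw [mul_comm]
  exact ((hf i).trans (Algebra.smul_def _ _)).symm

variable (K P) in
theorem generically_mem_specSubsemiring (a : Localization.AtPrime P) :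
    Generically (K := K) P fun _ w _ => a ∈ specSubsemiring P w := by
  obtain ⟨g, f, hg, hf⟩ := exists_common_denominator P fun _ : Unit => a
  refine (generically_subst_notMem hg).mono fun α w _ hw => ?_
  have hu : IsUnit (algebraMap (RSpec k n α) (Localization.AtPrime w) (subst k n α g)) :=
    IsLocalization.map_units (Localization.AtPrime w) (⟨_, hw⟩ : w.primeCompl)
  exact ⟨algebraMap _ _ (subst k n α (f ())) * ↑hu.unit⁻¹, incl k m n (f ()), incl k m n g, _, _,
    hg, hw, .of_incl α _, .of_incl α _, hf (), by simp [mul_assoc]⟩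

variable (K) in
theorem generically_matrix_mem {ι κ : Type*} [Finite ι] [Finite κ]
    (A : Matrix ι κ (Localization.AtPrime P)) :
    Generically (K := K) P fun _ w _ => ∀ i j, A i j ∈ specSubsemiring P w :=
  .forall fun i => .forall fun j => generically_mem_specSubsemiring K P (A i j)

end

/-! ### Specializing implications between linear systems -/

section

open Matrix

variable {k K : Type*} [Field k] [Field K] [Algebra k K] {m n : ℕ}

/-- The specialization `S → S_α` agrees on `k[u, X]` with substitution. -/
theorem map_incl_map_elemSpec {P : Ideal (R k m n)} [P.IsPrime] {α : Fin m → K}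
    {w : Ideal (RSpec k n α)} [w.IsPrime] {ι κ : Type*}
    (Y : Matrix ι κ (MvPolynomial (Fin n) (MvPolynomial (Fin m) k))) :
    (Y.map fun y => algebraMap (R k m n) (Localization.AtPrime P) (incl k m n y)).map
      (elemSpec P α w) =
        (Y.map (map (substCoeff k α))).map (algebraMap _ (Localization.AtPrime w)) := by
  ext i j
  exact (IsElemSpec.of_incl P w (Y i j)).elemSpec_eq

variable (P : Ideal (R k m n)) [P.IsPrime]

variable (K) in
/-- The kernel of a matrix over `S` is spanned by columns that still span the kernel after generic
specialization: a common denominator of the matrix is invertible, so the columns can be taken from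
the kernel of a matrix over `k[u, X]`. -/
theorem exists_generic_kernel {a κ : Type} [Fintype a] [Fintype κ]
    (T : Matrix a κ (Localization.AtPrime P)) :
    ∃ (q : ℕ) (Y : Matrix κ (Fin q) (Localization.AtPrime P)), T * Y = 0 ∧
      Generically (K := K) P fun α w _ => ∀ x, T.map (elemSpec P α w) *ᵥ x = 0 →
        ∃ y, Y.map (elemSpec P α w) *ᵥ y = x := by
  obtain ⟨g, f, hg, hf⟩ := exists_common_denominator P fun i : a × κ => T i.1 i.2
  -- the embedding of `k[u, X]` into `S`
  let ι : MvPolynomial (Fin n) (MvPolynomial (Fin m) k) →+* Localization.AtPrime P :=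
    (algebraMap (R k m n) (Localization.AtPrime P)).comp (incl k m n)
  let T' : Matrix a κ (MvPolynomial (Fin n) (MvPolynomial (Fin m) k)) :=
    Matrix.of fun i j => f (i, j)
  have hTT' : ι g • T = T'.map ι := by
    ext i j
    simpa [mul_comm, T', ι] using hf (i, j)
  obtain ⟨q, Y, hY⟩ := exists_exact_matrix T'
  have hTY : T' * Y = 0 := by
    ext1 i j
    have := congrFun (hY.apply_apply_eq_zero (Pi.single j 1)) i
    rwa [mulVecLin_apply, mulVecLin_apply, mulVec_mulVec, mulVec_single_one] at this
  have hu : IsUnit (ι g) :=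
    IsLocalization.map_units (Localization.AtPrime P) (⟨_, hg⟩ : P.primeCompl)
  obtain ⟨d, hd, H⟩ := exists_exact_map Y T' hY
  have hex : Generically (K := K) P fun α w _ => Function.Exact
      (Y.map (map (substCoeff k α))).mulVecLin (T'.map (map (substCoeff k α))).mulVecLin :=
    ⟨d, hd, fun α hα w _ _ => H _ _ (isUnit_iff_ne_zero.2 hα)⟩
  refine ⟨q, Y.map ι, ?_, ?_⟩
  · refine hu.smul_left_cancel.1 ?_
    rw [← Matrix.smul_mul, hTT', ← Matrix.map_mul, hTY, smul_zero]
    simp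
  · refine (hex.and (generically_matrix_mem K T)).mono fun α w _ ⟨h, hT⟩ x hx => ?_
    have h' := exact_map_localization (B := Localization.AtPrime w) w.primeCompl _ _ h
    obtain ⟨y, hy⟩ := (h' x).1 (by
      have h2 : (T'.map (map (substCoeff k α))).map (algebraMap _ (Localization.AtPrime w)) =
          algebraMap _ (Localization.AtPrime w) (subst k n α g) • T.map (elemSpec P α w) := by
        rw [← map_incl_map_elemSpec (P := P)]
        change (T'.map ι).map _ = _
        rw [← hTT']
        ext i j
        obtain ⟨b, hb⟩ := hT i j
        rw [map_apply, Matrix.smul_apply, Matrix.smul_apply, map_apply, hb.elemSpec_eq]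
        exact ((IsElemSpec.of_incl P w g).mul hb).elemSpec_eq
      rw [h2, mulVecLin_apply, smul_mulVec, hx, smul_zero])
    refine ⟨y, ?_⟩
    rw [← hy, mulVecLin_apply, ← map_incl_map_elemSpec (P := P)]
    rfl

variable (K) in
/-- An inclusion between the ranges of two matrices is witnessed by a matrix identity, which
specializes. -/
theorem generically_range_le {a b c : Type} [Fintype a] [Fintype b] [Fintype c] [DecidableEq b]
    (A : Matrix a b (Localization.AtPrime P)) (B : Matrix a c (Localization.AtPrime P))
    (h : ∀ x, ∃ z, B *ᵥ z = A *ᵥ x) :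
    Generically (K := K) P fun α w _ => ∀ x, ∃ z,
      B.map (elemSpec P α w) *ᵥ z = A.map (elemSpec P α w) *ᵥ x := by
  choose z hz using fun j : b => h (Pi.single j 1)
  let Z : Matrix c b (Localization.AtPrime P) := Matrix.of fun i j => z j i
  have hZ : B * Z = A := by
    ext i j
    have := congrFun (hz j) i
    rw [mulVec_single_one] at this
    exact this
  refine ((generically_matrix_mem K B).and (generically_matrix_mem K Z)).mono
    fun α w _ ⟨hB, hZ'⟩ x => ⟨Z.map (elemSpec P α w) *ᵥ x, ?_⟩
  rw [mulVec_mulVec, ← map_elemSpec_mul hB hZ', hZ]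

variable (K) in
/-- If the components in `b` of every solution of the system `A x + B z = 0` lie in the range of
`U`, then this remains true after generic specialization. -/
theorem generically_kernel_le {a b c e : Type} [Fintype a] [Fintype b] [Fintype c] [Fintype e]
    (A : Matrix a b (Localization.AtPrime P)) (B : Matrix a c (Localization.AtPrime P))
    (U : Matrix b e (Localization.AtPrime P))
    (h : ∀ x z, A *ᵥ x + B *ᵥ z = 0 → ∃ y, U *ᵥ y = x) :
    Generically (K := K) P fun α w _ => ∀ x z,
      A.map (elemSpec P α w) *ᵥ x + B.map (elemSpec P α w) *ᵥ z = 0 →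
        ∃ y, U.map (elemSpec P α w) *ᵥ y = x := by
  obtain ⟨q, Y, hTY, hY⟩ := exists_generic_kernel K P (fromCols A B)
  have h1 := generically_range_le K P Y.toRows₁ U fun y => h _ (Y.toRows₂ *ᵥ y) (by
    rw [← fromRows_toRows Y, fromCols_mul_fromRows] at hTY
    rw [mulVec_mulVec, mulVec_mulVec, ← add_mulVec]
    rw [hTY, zero_mulVec])
  refine (hY.and h1).mono fun α w _ ⟨H, H1⟩ x z hxz => ?_
  obtain ⟨y, hy⟩ := H (Sum.elim x z) (by
    rw [← hxz]
    ext i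
    simp [mulVec, dotProduct])
  obtain ⟨y', hy'⟩ := H1 y
  refine ⟨y', hy'.trans ?_⟩
  ext i
  exact congrFun hy (Sum.inl i)

end

/-! ### Exactness in terms of presentations -/

section

open Matrix

variable {S : Type*} [CommRing S] {L M N : Type*} [AddCommGroup L] [AddCommGroup M]
  [AddCommGroup N] [Module S L] [Module S M] [Module S N]

theorem Presentation.π_eq_zero_iff (p : Presentation S L) (x : Fin p.r₀ → S) :
    p.π x = 0 ↔ ∃ z, p.A *ᵥ z = x :=
  p.exact x

variable {pL : Presentation S L} {pM : Presentation S M} {pN : Presentation S N}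
  {f : L →ₗ[S] M} {g : M →ₗ[S] N} (lf : Lift pL pM f) (lg : Lift pM pN g)

theorem Lift.apply_π (x : Fin pL.r₀ → S) : f (pL.π x) = pM.π (lf.V₀ *ᵥ x) :=
  (LinearMap.congr_fun lf.comm₀ x).symm

/-- Injectivity of `f`, read off from the matrices of a lift. -/
theorem Lift.injective_iff : Function.Injective f ↔
    ∀ x z, lf.V₀ *ᵥ x + pM.A *ᵥ z = 0 → ∃ y, pL.A *ᵥ y = x := by
  rw [← LinearMap.ker_eq_bot, LinearMap.ker_eq_bot']
  constructor
  · intro h x z hxz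
    refine (pL.π_eq_zero_iff x).1 (h _ ?_)
    rw [lf.apply_π, pM.π_eq_zero_iff]
    exact ⟨-z, by rw [mulVec_neg, eq_neg_of_add_eq_zero_left hxz]⟩
  · intro h l hl
    obtain ⟨x, rfl⟩ := pL.surjective l
    rw [lf.apply_π, pM.π_eq_zero_iff] at hl
    obtain ⟨z, hz⟩ := hl
    exact (pL.π_eq_zero_iff x).2 (h x (-z) (by rw [mulVec_neg, hz, add_neg_cancel]))

/-- Surjectivity of `f`, read off from the matrices of a lift. -/
theorem Lift.surjective_iff : Function.Surjective f ↔
    ∀ y, ∃ x, fromCols lf.V₀ pM.A *ᵥ x = y := by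
  constructor
  · intro h y
    obtain ⟨l, hl⟩ := h (pM.π y)
    obtain ⟨x, rfl⟩ := pL.surjective l
    rw [lf.apply_π, eq_comm, ← sub_eq_zero, ← map_sub, pM.π_eq_zero_iff] at hl
    obtain ⟨z, hz⟩ := hl
    refine ⟨Sum.elim x z, ?_⟩
    rw [fromCols_mulVec_sumElim, hz, add_sub_cancel]
  · intro h l
    obtain ⟨y, rfl⟩ := pM.surjective l
    obtain ⟨x, rfl⟩ := h y
    refine ⟨pL.π (x ∘ Sum.inl), ?_⟩
    rw [lf.apply_π, eq_comm, ← sub_eq_zero, ← map_sub, pM.π_eq_zero_iff]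
    exact ⟨x ∘ Sum.inr, by rw [fromCols_mulVec, add_sub_cancel_left]⟩

/-- Exactness at `M`, read off from the matrices of lifts of `f` and `g`. -/
theorem Lift.exact_iff : Function.Exact f g ↔
    (∀ x, ∃ z, pN.A *ᵥ z = (lg.V₀ * lf.V₀) *ᵥ x) ∧
      ∀ x z, lg.V₀ *ᵥ x + pN.A *ᵥ z = 0 → ∃ y, fromCols lf.V₀ pM.A *ᵥ y = x := by
  constructor
  · refine fun h => ⟨fun x => ?_, fun x z hxz => ?_⟩
    · rw [← pN.π_eq_zero_iff, ← mulVec_mulVec, ← lg.apply_π, ← lf.apply_π, h.apply_apply_eq_zero]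
    · obtain ⟨l, hl⟩ := (h (pM.π x)).1 (by
        rw [lg.apply_π, pN.π_eq_zero_iff]
        exact ⟨-z, by rw [mulVec_neg, eq_neg_of_add_eq_zero_left hxz]⟩)
      obtain ⟨y, rfl⟩ := pL.surjective l
      rw [lf.apply_π, eq_comm, ← sub_eq_zero, ← map_sub, pM.π_eq_zero_iff] at hl
      obtain ⟨z', hz'⟩ := hl
      refine ⟨Sum.elim y z', ?_⟩
      rw [fromCols_mulVec_sumElim, hz', add_sub_cancel]
  · rintro ⟨h1, h2⟩ y
    obtain ⟨x, rfl⟩ := pM.surjective y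
    constructor
    · intro h
      rw [lg.apply_π, pN.π_eq_zero_iff] at h
      obtain ⟨z, hz⟩ := h
      obtain ⟨y, rfl⟩ := h2 x (-z) (by rw [mulVec_neg, hz, add_neg_cancel])
      refine ⟨pL.π (y ∘ Sum.inl), ?_⟩
      rw [lf.apply_π, eq_comm, ← sub_eq_zero, ← map_sub, pM.π_eq_zero_iff]
      exact ⟨y ∘ Sum.inr, by rw [fromCols_mulVec, add_sub_cancel_left]⟩
    · rintro ⟨l, hl⟩
      obtain ⟨y, rfl⟩ := pL.surjective l
      rw [← hl, lf.apply_π, lg.apply_π, mulVec_mulVec, pN.π_eq_zero_iff]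
      exact h1 y

end

/-! ### Specialized presentations and homomorphisms -/

section

variable {k K : Type*} [Field k] [Field K] [Algebra k K] {m n : ℕ} {P : Ideal (R k m n)}
  [P.IsPrime] {L M : Type*} [AddCommGroup L] [AddCommGroup M]
  [Module (Localization.AtPrime P) L] [Module (Localization.AtPrime P) M]

/-- The specialized presentation `F₁_α → F₀_α → L_α → 0`. -/
def Presentation.spec (p : Presentation (Localization.AtPrime P) L) (α : Fin m → K)
    (w : Ideal (RSpec k n α)) [w.IsPrime] :
    Presentation (Localization.AtPrime w) (ModuleSpec p α w) where
  r₁ := p.r₁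
  r₀ := p.r₀
  A := matrixSpec P α w p.A
  π := Submodule.mkQ _
  exact := LinearMap.exact_map_mkQ_range _
  surjective := Submodule.mkQ_surjective _

variable {p : Presentation (Localization.AtPrime P) L}
  {q : Presentation (Localization.AtPrime P) M} {v : L →ₗ[Localization.AtPrime P] M}

variable (K) in
theorem Lift.generically_exists_isHomSpec (l : Lift p q v) :
    Generically (K := K) P fun α w _ => ∃ v', IsHomSpec l α w v' := by
  refine ((generically_matrix_mem K p.A).and ((generically_matrix_mem K q.A).and
    ((generically_matrix_mem K l.V₁).and (generically_matrix_mem K l.V₀)))).mono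
    fun α w _ ⟨hp, hq, h₁, h₀⟩ => ?_
  have hc : matrixSpec P α w q.A * matrixSpec P α w l.V₁ =
      matrixSpec P α w l.V₀ * matrixSpec P α w p.A := by
    rw [matrixSpec, matrixSpec, matrixSpec, matrixSpec, ← map_elemSpec_mul hq h₁, l.comm₁,
      map_elemSpec_mul h₀ hp]
  refine ⟨Submodule.mapQ _ _ (matrixSpec P α w l.V₀).mulVecLin ?_, hp, hq, h₁, h₀, hc,
    Submodule.mapQ_mkQ _ _ _⟩
  rintro _ ⟨x, rfl⟩
  refine ⟨(matrixSpec P α w l.V₁).mulVec x, ?_⟩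
  simp only [Matrix.mulVecLin_apply, Matrix.mulVec_mulVec, hc]

/-- A specialized homomorphism lifts to the specialized presentations. -/
def IsHomSpec.lift {l : Lift p q v} {α : Fin m → K} {w : Ideal (RSpec k n α)} [w.IsPrime]
    {v' : ModuleSpec p α w →ₗ[Localization.AtPrime w] ModuleSpec q α w}
    (h : IsHomSpec l α w v') : Lift (p.spec α w) (q.spec α w) v' where
  V₁ := matrixSpec P α w l.V₁
  V₀ := matrixSpec P α w l.V₀
  comm₁ := h.comm₁
  comm₀ := h.comm₀.symm

end

/-! ### Specialization of short exact sequences -/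

section

open Matrix

/-- Exactness of the sequence amounts to finitely many implications between linear systems in the
matrices of the presentations and lifts, and each of them specializes. -/
theorem generically_exists_exact {k K : Type*} [Field k] [Field K] [Algebra k K] {m n : ℕ}
    (P : Ideal (R k m n)) [P.IsPrime]
    {L M N : Type*} [AddCommGroup L] [AddCommGroup M] [AddCommGroup N]
    [Module (Localization.AtPrime P) L] [Module (Localization.AtPrime P) M]
    [Module (Localization.AtPrime P) N]
    (f : L →ₗ[Localization.AtPrime P] M) (g : M →ₗ[Localization.AtPrime P] N)
    (hf : Function.Injective f) (hfg : Function.Exact f g) (hg : Function.Surjective g)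
    (pL : Presentation (Localization.AtPrime P) L)
    (pM : Presentation (Localization.AtPrime P) M)
    (pN : Presentation (Localization.AtPrime P) N)
    (lf : Lift pL pM f) (lg : Lift pM pN g) :
    Generically (K := K) P fun α w _ =>
      ∃ (f' : ModuleSpec pL α w →ₗ[Localization.AtPrime w] ModuleSpec pM α w)
        (g' : ModuleSpec pM α w →ₗ[Localization.AtPrime w] ModuleSpec pN α w),
        IsHomSpec lf α w f' ∧ IsHomSpec lg α w g' ∧
          Function.Injective f' ∧ Function.Exact f' g' ∧ Function.Surjective g' := by
  have hi := generically_kernel_le K P _ _ _ (lf.injective_iff.1 hf)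
  obtain ⟨h0, h1⟩ := (lf.exact_iff lg).1 hfg
  have hc := generically_range_le K P _ _ h0
  have he := generically_kernel_le K P _ _ _ h1
  have hs := generically_range_le K P 1 (fromCols lg.V₀ pN.A) fun y => by
    rw [one_mulVec]
    exact lg.surjective_iff.1 hg y
  refine (((lf.generically_exists_isHomSpec K).and
    (lg.generically_exists_isHomSpec K)).and (hi.and (hc.and (he.and hs)))).mono
    fun α w _ ⟨⟨⟨f', hf'⟩, ⟨g', hg'⟩⟩, Hi, Hc, He, Hs⟩ => ?_
  have hcols (a b c : ℕ) (A : Matrix (Fin a) (Fin b) (Localization.AtPrime P))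
      (B : Matrix (Fin a) (Fin c) (Localization.AtPrime P)) :
      (fromCols A B).map (elemSpec P α w) =
        fromCols (matrixSpec P α w A) (matrixSpec P α w B) := by
    ext i (j | j) <;> rfl
  rw [map_elemSpec_mul hg'.defined₀ hf'.defined₀] at Hc
  rw [hcols] at He
  refine ⟨f', g', hf', hg', hf'.lift.injective_iff.2 Hi, (hf'.lift.exact_iff hg'.lift).2 ⟨Hc, He⟩,
    hg'.lift.surjective_iff.2 fun y => ?_⟩
  rw [map_elemSpec_one] at Hs
  rw [hcols] at Hs
  obtain ⟨x, hx⟩ := Hs y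
  exact ⟨x, hx.trans (one_mulVec y)⟩

end

end ModuleSpecialization

end

theorem theorem2p2 {k K : Type*} [Field k] [Field K] [Algebra k K] [Infinite K] {m n : ℕ}
    (P : Ideal (ModuleSpecialization.R k m n)) [P.IsPrime]
    {L M N : Type*} [AddCommGroup L] [AddCommGroup M] [AddCommGroup N]
    [Module (Localization.AtPrime P) L] [Module (Localization.AtPrime P) M]
    [Module (Localization.AtPrime P) N]
    [Module.Finite (Localization.AtPrime P) L] [Module.Finite (Localization.AtPrime P) M]
    [Module.Finite (Localization.AtPrime P) N]
    (f : L →ₗ[Localization.AtPrime P] M) (g : M →ₗ[Localization.AtPrime P] N)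
    (hf : Function.Injective f) (hfg : Function.Exact f g) (hg : Function.Surjective g)
    (pL : ModuleSpecialization.Presentation (Localization.AtPrime P) L)
    (pM : ModuleSpecialization.Presentation (Localization.AtPrime P) M)
    (pN : ModuleSpecialization.Presentation (Localization.AtPrime P) N)
    (lf : ModuleSpecialization.Lift pL pM f) (lg : ModuleSpecialization.Lift pM pN g) :
    ModuleSpecialization.AlmostAll fun α : Fin m → K =>
      ∀ (w : Ideal (ModuleSpecialization.RSpec k n α)) [w.IsPrime],
        w ∈ associatedPrimes (ModuleSpecialization.RSpec k n α)
          (ModuleSpecialization.RSpec k n α ⧸ ModuleSpecialization.idealSpec P α) →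
        ∃ (f' : ModuleSpecialization.ModuleSpec pL α w →ₗ[Localization.AtPrime w]
              ModuleSpecialization.ModuleSpec pM α w)
          (g' : ModuleSpecialization.ModuleSpec pM α w →ₗ[Localization.AtPrime w]
              ModuleSpecialization.ModuleSpec pN α w),
          ModuleSpecialization.IsHomSpec lf α w f' ∧ ModuleSpecialization.IsHomSpec lg α w g' ∧
          Function.Injective f' ∧ Function.Exact f' g' ∧ Function.Surjective g' :=
  (ModuleSpecialization.generically_exists_exact P f g hf hfg hg pL pM pN lf lg).almostAll
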